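/- Let $X$ be a real random variable with distribution function $F(t)=\mathbb P(X\le t)$, let $\alpha\in(0,\tfrac12)$, and set \[ \mathrm{VaR}_u(F)=\inf\{t: F(t)\ge u\},\qquad \mathrm{ES}_\alpha(X)=\frac1\alpha\int_{1-\alpha}^1 \mathrm{VaR}_u(F)\,du, \] \[ \sigma^2=\sigma^2_{\mathrm{ES}_\alpha(X)}=\frac1{\alpha^2}\int_{\mathrm{VaR}_{1-\alpha}(F)}^\infty\int_{\mathrm{VaR}_{1-\alpha}(F)}^\infty \big(F(\min\{t,s\})-F(t)F(s)\big)\,dt\,ds\in[0,\infty]. \] Let $X_1,\dots,X_N$ be independent copies of $X$ and let $0.35\le\beta_1\le\beta_2\le0.65$. For a nonempty $I\subset\{1,\dots,N\}$ let $\widehat T_I=\frac1\alpha\int_{1-\alpha}^1\mathrm{VaR}_u(\widehat F_I)\,du$ with $\widehat F_I(t)=\frac1{|I|}\sum_{i\in I}\mathbf 1_{\{X_i\le t\}}$, and let $\widehat T_N=\widehat T_{\{1,\dots,N\}}$. For $\varepsilon>0$ put $m=\lceil 11/\varepsilon^2\rceil$, $n=\lfloor N/m\rfloor$, $I_j=\{(j-1)m+1,\dots,jm\}$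 for $1\le j\le n$; let $\widehat T_{(1)}\le\dots\le\widehat T_{(n)}$ be the order statistics of $(\widehat T_{I_j})_{j\le n}$, let $\widehat Q$ be the function on $[0,1]$ that takes the value $\widehat T_{(j)}$ at $\frac{j-1}{n-1}$ ($1\le j\le n$) and is linear in between, and let \[ \widehat S_N=\min\{\max\{\widehat T_N,\widehat Q(\beta_1)\},\widehat Q(\beta_2)\}. \] There are absolute constants $c_0,c_1,c_2,c_3>0$ such that the following holds for all $\alpha$, $\beta_1$, $\beta_2$, $X$ and $N$ as above. Assume that $\sigma^2<\infty$, that $u\mapsto\mathrm{VaR}_u(F)$ is $L$-Lipschitz on $[1-2\alpha,1-\frac12\alpha]$ for some $L\ge0$, that $L$ and $\sigma$ are not both zero, and that $0<\varepsilon<c_0\sqrt\alpha$ and $N\ge c_1\varepsilon^{-2}$. Then \[ \mathbb P\big(|\widehat S_N-\mathrm{ES}_\alpha(X)|\ge \varepsilon\sigma+c_2L\varepsilon^2\big)\le\exp(-c_3N\varepsilon^2), \] and if in addition $\varepsilon\le\frac{\sigma}{c_2L}$ (no condition if $L=0$), then, with the same constants, \[ \mathbb P\big(|\widehat S_N-\mathrm{ES}_\alpha(X)|\ge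 2\varepsilon\sigma\big)\le\exp(-c_3N\varepsilon^2). \] -/

import Mathlib

open MeasureTheory ProbabilityTheory
open scoped ENNReal NNReal

noncomputable section

namespace ExpShortfall

/-- The distribution function `F_X(t) = P(X ≤ t)` of a random variable. -/
def distFun {Ω : Type*} [MeasurableSpace Ω] (P : Measure Ω) (X : Ω → ℝ) (t : ℝ) : ℝ :=
  P.real {ω | X ω ≤ t}

/-- The value at risk `VaR_u(F) = inf {t : F(t) ≥ u}` of a distribution function `F`.
For `0 < u < 1` the set is nonempty and bounded below. -/
def valueAtRisk (F : ℝ → ℝ) (u : ℝ) : ℝ :=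
  sInf {t : ℝ | u ≤ F t}

/-- The expected shortfall `ES_α(F) = (1/α) ∫_{1-α}^1 VaR_u(F) du` of a distribution function. -/
def expShortfall (α : ℝ) (F : ℝ → ℝ) : ℝ :=
  (1 / α) * ∫ u in (1 - α)..1, valueAtRisk F u

/-- The variance `σ²_{ES_α}` with values in `[0, ∞]`: the double integral of
`F(min(t,s)) - F(t) F(s)` over `(VaR_{1-α}, ∞)²`, divided by `α²`.
The integrand is nonnegative for every distribution function `F`. -/
def esVariance (α : ℝ) (F : ℝ → ℝ) : ℝ≥0∞ :=
  ENNReal.ofReal (1 / α ^ 2) *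
    ∫⁻ t in Set.Ioi (valueAtRisk F (1 - α)), ∫⁻ s in Set.Ioi (valueAtRisk F (1 - α)),
      ENNReal.ofReal (F (min t s) - F t * F s)

/-- The standard deviation `σ_{ES_α}` (meaningful when `esVariance α F` is finite). -/
def esStdDev (α : ℝ) (F : ℝ → ℝ) : ℝ :=
  Real.sqrt (esVariance α F).toReal

/-- The empirical distribution function of the data `(x i)_{i ∈ I}`. -/
def empDistFun {ι : Type*} (I : Finset ι) (x : ι → ℝ) (t : ℝ) : ℝ :=
  (1 / (I.card : ℝ)) * ∑ i ∈ I, Set.indicator (Set.Iic t) (fun _ => (1 : ℝ)) (x i)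

/-- The plug-in estimator computed from the data `(x i)_{i ∈ I}`. -/
def plugIn {ι : Type*} (α : ℝ) (I : Finset ι) (x : ι → ℝ) : ℝ :=
  expShortfall α (empDistFun I x)

/-- The block size `m = ⌈11 / ε²⌉`. -/
def blockSize (ε : ℝ) : ℕ := ⌈11 / ε ^ 2⌉₊

/-- The number of blocks `n = ⌊N / m⌋` (natural-number division). -/
def numBlocks (ε : ℝ) (N : ℕ) : ℕ := N / blockSize ε

/-- The blocks of `m` consecutive indices, with data and blocks numbered from `0`:
block `j` is `{j m, …, (j + 1) m - 1}`. -/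
def block (N m j : ℕ) : Finset (Fin N) :=
  Finset.univ.filter fun i : Fin N => j * m ≤ (i : ℕ) ∧ (i : ℕ) < (j + 1) * m

/-- The order statistics of `T`, numbered from `0` (the value is `0` for `k ≥ n`). -/
def orderStat {n : ℕ} (T : Fin n → ℝ) (k : ℕ) : ℝ :=
  if h : k < n then T (Tuple.sort T ⟨k, h⟩) else 0

/-- The linearly interpolated empirical quantile function on `[0, 1]`: it takes the value
`orderStat T k` at `k / (n - 1)`, for `k = 0, …, n - 1`, and is linear between these points. -/
def interpQuantile {n : ℕ} (T : Fin n → ℝ) (β : ℝ) : ℝ :=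
  let h : ℝ := ((n : ℝ) - 1) * β
  orderStat T ⌊h⌋₊ + (h - (⌊h⌋₊ : ℝ)) * (orderStat T (⌊h⌋₊ + 1) - orderStat T ⌊h⌋₊)

/-- The plug-in estimators on the `n` blocks. -/
def blockEstimates (α ε : ℝ) {N : ℕ} (x : Fin N → ℝ) : Fin (numBlocks ε N) → ℝ :=
  fun j => plugIn α (block N (blockSize ε) (j : ℕ)) x

/-- The estimator `Ŝ_N`: the plug-in estimator on the whole sample, truncated to the interval
between the `β₁`- and the `β₂`-quantile of the block estimators. -/
def truncatedEstimator (α ε β₁ β₂ : ℝ) {N : ℕ} (x : Fin N → ℝ) : ℝ :=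
  min (max (plugIn α Finset.univ x) (interpQuantile (blockEstimates α ε x) β₁))
    (interpQuantile (blockEstimates α ε x) β₂)

end ExpShortfall

end

/-!
By Rockafellar and Uryasev, `ES_α(F) = min_q (q + (1/α) ∫ (x - q)₊ dF)`, with the minimum attained
at every `(1 - α)`-quantile. Fix `q = VaR_{1-α}(F)`. For an empirical distribution the objective at
`q` is a sample mean, whose variance is governed by `σ²` because Hoeffding's covariance formula
gives `Var (X - q)₊ = α² σ²`. If the empirical tails at `q` and `q ± L δ` deviate by at most `δ`,
the objective at `q` exceeds its minimum, the plug-in estimator, by at most `L δ² / α`.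
With `δ = 4 ε √α`, Chebyshev's inequality for this sample mean and for four frequencies shows that
a block of size `m ≥ 11 / ε²` has an error above `ε σ + 32 L ε²` with probability at most `1/8`.

The blocks are independent, so by Hoeffding's inequality fewer than `0.3 n` of them are bad outside
an event of exponentially small probability. Then every order statistic of rank between `0.3 n` and
`0.7 n` lies in the good interval, hence so do both interpolated quantiles, and the truncation to
the interval between them inherits the bound whatever the plug-in estimator on the whole sample is.
-/

namespace ExpShortfall

open Set Filter Topology

section Quantile

variable (μ : Measure ℝ)

theorem le_cdf_valueAtRisk {u : ℝ} (hu₁ : u < 1) :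
    u ≤ cdf μ (valueAtRisk (cdf μ) u) := by
  have hne : {t : ℝ | u ≤ cdf μ t}.Nonempty :=
    ((tendsto_cdf_atTop μ).eventually (lt_mem_nhds hu₁)).exists.imp fun _ h => h.le
  refine ge_of_tendsto (((cdf μ).right_continuous _).tendsto.mono_left
    (nhdsWithin_mono _ Ioi_subset_Ici_self)) ?_
  filter_upwards [self_mem_nhdsWithin] with s hs
  obtain ⟨r, hr, hrs⟩ := exists_lt_of_csInf_lt hne hs
  exact le_trans hr (monotone_cdf μ hrs.le)

theorem valueAtRisk_cdf_le_iff {u : ℝ} (hu₀ : 0 < u) (hu₁ : u < 1) {t : ℝ} :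
    valueAtRisk (cdf μ) u ≤ t ↔ u ≤ cdf μ t := by
  obtain ⟨b, hb⟩ := ((tendsto_cdf_atBot μ).eventually (gt_mem_nhds hu₀)).exists
  have hbdd : BddBelow {t : ℝ | u ≤ cdf μ t} :=
    ⟨b, fun t ht => le_of_not_gt fun hlt => (ht.trans (monotone_cdf μ hlt.le)).not_gt hb⟩
  exact ⟨fun h => (le_cdf_valueAtRisk μ hu₁).trans (monotone_cdf μ h), fun h => csInf_le hbdd h⟩

theorem monotoneOn_valueAtRisk_cdf : MonotoneOn (valueAtRisk (cdf μ)) (Ioo 0 1) :=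
  fun _ hu _ hv huv =>
    (valueAtRisk_cdf_le_iff μ hu.1 hu.2).2 (huv.trans (le_cdf_valueAtRisk μ hv.2))

variable [IsProbabilityMeasure μ]

theorem hasLaw_valueAtRisk_cdf : HasLaw (valueAtRisk (cdf μ)) μ (volume.restrict (Ioo 0 1)) := by
  have hmeas : AEMeasurable (valueAtRisk (cdf μ)) (volume.restrict (Ioo 0 1)) :=
    aemeasurable_restrict_of_monotoneOn measurableSet_Ioo (monotoneOn_valueAtRisk_cdf μ)
  refine ⟨hmeas, Measure.ext_of_Iic _ _ fun t => ?_⟩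
  have hpre : valueAtRisk (cdf μ) ⁻¹' Iic t =ᵐ[volume.restrict (Ioo 0 1)] Iic (cdf μ t) := by
    filter_upwards [ae_restrict_mem measurableSet_Ioo] with u hu
    exact propext (valueAtRisk_cdf_le_iff μ hu.1 hu.2)
  rw [Measure.map_apply_of_aemeasurable hmeas measurableSet_Iic, measure_congr hpre,
    Measure.restrict_congr_set Ioo_ae_eq_Ioc, Measure.restrict_apply measurableSet_Iic,
    Iic_inter_Ioc_of_le (cdf_le_one μ t), Real.volume_Ioc, sub_zero, ofReal_cdf]

theorem measureReal_Ioi_eq_one_sub_cdf (t : ℝ) : μ.real (Ioi t) = 1 - cdf μ t := by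
  rw [cdf_eq_real, ← compl_Iic, probReal_compl_eq_one_sub measurableSet_Iic]

theorem measure_Ioi_eq_ofReal_one_sub_cdf (t : ℝ) :
    μ (Ioi t) = ENNReal.ofReal (1 - cdf μ t) := by
  rw [← measureReal_Ioi_eq_one_sub_cdf, ofReal_measureReal]

theorem valueAtRisk_cdf_le_iff_measureReal_Ioi_le {u : ℝ} (hu₀ : 0 < u) (hu₁ : u < 1) {t : ℝ} :
    valueAtRisk (cdf μ) u ≤ t ↔ μ.real (Ioi t) ≤ 1 - u := by
  rw [valueAtRisk_cdf_le_iff μ hu₀ hu₁, measureReal_Ioi_eq_one_sub_cdf, sub_le_sub_iff_left]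

theorem le_measureReal_Ici_of_le_valueAtRisk_cdf {u : ℝ} (hu₀ : 0 < u) (hu₁ : u < 1) {t : ℝ}
    (ht : t ≤ valueAtRisk (cdf μ) u) : 1 - u ≤ μ.real (Ici t) := by
  have hlt : ∀ᶠ s in 𝓝[<] t, cdf μ s ≤ u := by
    filter_upwards [self_mem_nhdsWithin] with s hs
    exact (lt_of_not_ge fun hle =>
      (hs.trans_le ht).not_ge ((valueAtRisk_cdf_le_iff μ hu₀ hu₁).2 hle)).le
  have hleft : Function.leftLim (cdf μ) t ≤ u :=
    le_of_tendsto ((monotone_cdf μ).tendsto_leftLim t) hlt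
  have hIio : μ.real (Iio t) ≤ u := by
    rw [measureReal_def, ← measure_cdf μ, (cdf μ).measure_Iio (tendsto_cdf_atBot μ), sub_zero]
    exact ENNReal.toReal_le_of_le_ofReal hu₀.le (ENNReal.ofReal_le_ofReal hleft)
  rw [← compl_Iio, probReal_compl_eq_one_sub measurableSet_Iio]
  linarith

theorem le_valueAtRisk_cdf_of_lt_measureReal_Ici {u : ℝ} (hu₁ : u < 1) {t : ℝ}
    (ht : 1 - u < μ.real (Ici t)) : t ≤ valueAtRisk (cdf μ) u := by
  by_contra! hlt
  have hsub : μ.real (Ici t) ≤ μ.real (Ioi (valueAtRisk (cdf μ) u)) :=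
    measureReal_mono fun _ hx => hlt.trans_le hx
  rw [measureReal_Ioi_eq_one_sub_cdf] at hsub
  linarith [le_cdf_valueAtRisk μ hu₁]

end Quantile

section TailObjective

variable (μ : Measure ℝ)

/-- The objective `q + (1/α) E (X - q)₊` of Rockafellar and Uryasev for a variable `X` with law
`μ`. Its minimum over `q` is the expected shortfall, attained at the value at risk; unlike the
latter it is, for fixed `q`, an expectation. -/
noncomputable def tailObjective (α : ℝ) (μ : Measure ℝ) (q : ℝ) : ℝ :=
  q + (1 / α) * ∫ x, max (x - q) 0 ∂μ

theorem max_valueAtRisk_cdf_sub_eqOn {u : ℝ} (hu₀ : 0 < u) (hu₁ : u < 1) :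
    EqOn (fun v => max (valueAtRisk (cdf μ) v - valueAtRisk (cdf μ) u) 0)
      ((Ioo u 1).indicator fun v => valueAtRisk (cdf μ) v - valueAtRisk (cdf μ) u) (Ioo 0 1) := by
  intro v hv
  have hmono := monotoneOn_valueAtRisk_cdf μ
  rcases lt_or_ge u v with huv | hvu
  · simpa only [indicator_of_mem (show v ∈ Ioo u 1 from ⟨huv, hv.2⟩)] using
      max_eq_left (sub_nonneg.2 (hmono ⟨hu₀, hu₁⟩ hv huv.le))
  · simpa only [indicator_of_notMem fun h : v ∈ Ioo u 1 => hvu.not_gt h.1] using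
      max_eq_right (sub_nonpos.2 (hmono hv ⟨hu₀, hu₁⟩ hvu))

section Integrable

variable {μ} [IsFiniteMeasure μ]

theorem integrable_max_sub {q : ℝ} (hq : Integrable (fun x => max (x - q) 0) μ) (r : ℝ) :
    Integrable (fun x => max (x - r) 0) μ := by
  refine (hq.add (integrable_const |q - r|)).mono' (by fun_prop) (Eventually.of_forall fun x => ?_)
  rw [Real.norm_of_nonneg (le_max_right _ _), Pi.add_apply]
  refine max_le ?_ (add_nonneg (le_max_right _ _) (abs_nonneg _))
  linarith [le_max_left (x - q) 0, le_abs_self (q - r)]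

theorem tailObjective_add_mul_le {α : ℝ} (hα : 0 < α) {q : ℝ}
    (hq : Integrable (fun x => max (x - q) 0) μ) {S : Set ℝ} (hS : MeasurableSet S)
    (hqS : Ioi q ⊆ S) (hSq : S ⊆ Ici q) (r : ℝ) :
    tailObjective α μ q + (r - q) * (1 - μ.real S / α) ≤ tailObjective α μ r := by
  have hind : Integrable (S.indicator fun _ => q - r) μ := (integrable_const _).indicator hS
  have hle : ∫ x, (max (x - q) 0 + S.indicator (fun _ => q - r) x) ∂μ ≤
      ∫ x, max (x - r) 0 ∂μ := by
    refine integral_mono (hq.add hind) (integrable_max_sub hq r) fun x => ?_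
    by_cases hx : x ∈ S
    · have hqx : q ≤ x := hSq hx
      simp only [indicator_of_mem hx, max_eq_left (sub_nonneg.2 hqx)]
      exact le_max_of_le_left (by linarith)
    · have hxq : x ≤ q := not_lt.1 fun hlt => hx (hqS hlt)
      simp only [indicator_of_notMem hx, max_eq_right (sub_nonpos.2 hxq), add_zero]
      exact le_max_right _ _
  rw [integral_add hq hind, integral_indicator_const _ hS, smul_eq_mul] at hle
  calc tailObjective α μ q + (r - q) * (1 - μ.real S / α)
      = r + (1 / α) * (∫ x, max (x - q) 0 ∂μ + μ.real S * (q - r)) := by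
        rw [tailObjective]; ring
    _ ≤ tailObjective α μ r := by rw [tailObjective]; gcongr

theorem tailObjective_sub_le {α : ℝ} (hα : 0 < α) {q δ : ℝ}
    (hq : Integrable (fun x => max (x - q) 0) μ) (hIci : α - δ ≤ μ.real (Ici q))
    (hIoi : μ.real (Ioi q) ≤ α + δ) (r : ℝ) :
    tailObjective α μ q - |r - q| * (δ / α) ≤ tailObjective α μ r := by
  rcases le_total q r with hqr | hrq
  · have hslope : -(δ / α) ≤ 1 - μ.real (Ioi q) / α := by
      have := (div_le_div_iff_of_pos_right hα).2 hIoi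
      rw [add_div, div_self hα.ne'] at this
      linarith
    have := tailObjective_add_mul_le hα hq measurableSet_Ioi subset_rfl Ioi_subset_Ici_self r
    rw [abs_of_nonneg (sub_nonneg.2 hqr)]
    linarith [mul_le_mul_of_nonneg_left hslope (sub_nonneg.2 hqr)]
  · have hslope : 1 - μ.real (Ici q) / α ≤ δ / α := by
      have := (div_le_div_iff_of_pos_right hα).2 hIci
      rw [sub_div, div_self hα.ne'] at this
      linarith
    have := tailObjective_add_mul_le hα hq measurableSet_Ici Ioi_subset_Ici_self subset_rfl r
    rw [abs_of_nonpos (sub_nonpos.2 hrq)]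
    linarith [mul_le_mul_of_nonpos_left hslope (sub_nonpos.2 hrq)]

end Integrable

variable [IsProbabilityMeasure μ]

theorem integral_max_sub_valueAtRisk_cdf {u : ℝ} (hu₀ : 0 < u) (hu₁ : u < 1) :
    ∫ x, max (x - valueAtRisk (cdf μ) u) 0 ∂μ =
      ∫ v in Ioo u 1, (valueAtRisk (cdf μ) v - valueAtRisk (cdf μ) u) := by
  have hmeas : Measurable fun x : ℝ => max (x - valueAtRisk (cdf μ) u) 0 := by fun_prop
  calc ∫ x, max (x - valueAtRisk (cdf μ) u) 0 ∂μ
      = ∫ v in Ioo 0 1, max (valueAtRisk (cdf μ) v - valueAtRisk (cdf μ) u) 0 := by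
        exact ((hasLaw_valueAtRisk_cdf μ).integral_comp hmeas.aestronglyMeasurable).symm
    _ = ∫ v in Ioo u 1, (valueAtRisk (cdf μ) v - valueAtRisk (cdf μ) u) := by
        rw [setIntegral_congr_fun measurableSet_Ioo (max_valueAtRisk_cdf_sub_eqOn μ hu₀ hu₁),
          setIntegral_indicator measurableSet_Ioo,
          inter_eq_right.2 (Ioo_subset_Ioo_left hu₀.le)]

theorem integrableOn_valueAtRisk_cdf_sub {u : ℝ} (hu₀ : 0 < u) (hu₁ : u < 1)
    (hint : Integrable (fun x => max (x - valueAtRisk (cdf μ) u) 0) μ) :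
    IntegrableOn (fun v => valueAtRisk (cdf μ) v - valueAtRisk (cdf μ) u) (Ioo u 1) := by
  have hlaw := hasLaw_valueAtRisk_cdf μ
  have hcomp : IntegrableOn (fun v => max (valueAtRisk (cdf μ) v - valueAtRisk (cdf μ) u) 0)
      (Ioo 0 1) := by
    refine Integrable.comp_aemeasurable (g := fun x => max (x - valueAtRisk (cdf μ) u) 0) ?_
      hlaw.aemeasurable
    rwa [hlaw.map_eq]
  have hIoo := hcomp.congr_fun (max_valueAtRisk_cdf_sub_eqOn μ hu₀ hu₁) measurableSet_Ioo
  rwa [IntegrableOn, integrable_indicator_iff measurableSet_Ioo, IntegrableOn,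
    Measure.restrict_restrict measurableSet_Ioo,
    inter_eq_left.2 (Ioo_subset_Ioo_left hu₀.le)] at hIoo

variable {μ} {α q : ℝ}

theorem expShortfall_cdf_eq_tailObjective (hα₀ : 0 < α) (hα₁ : α < 1)
    (hq : Integrable (fun x => max (x - q) 0) μ) :
    expShortfall α (cdf μ) = tailObjective α μ (valueAtRisk (cdf μ) (1 - α)) := by
  have hu₀ : 0 < 1 - α := by linarith
  have hu₁ : 1 - α < 1 := by linarith
  have hsub := integrableOn_valueAtRisk_cdf_sub μ hu₀ hu₁ (integrable_max_sub hq _)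
  have hconst : IntegrableOn (fun _ => valueAtRisk (cdf μ) (1 - α)) (Ioo (1 - α) 1) :=
    integrableOn_const (by simp)
  have hsum : ∫ v in Ioo (1 - α) 1, valueAtRisk (cdf μ) v =
      ∫ x, max (x - valueAtRisk (cdf μ) (1 - α)) 0 ∂μ + α * valueAtRisk (cdf μ) (1 - α) := by
    have := integral_add hsub hconst
    simpa [integral_max_sub_valueAtRisk_cdf μ hu₀ hu₁, hα₀.le] using this
  rw [expShortfall, tailObjective, intervalIntegral.integral_of_le hu₁.le,
    integral_Ioc_eq_integral_Ioo, hsum]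
  field_simp
  ring

theorem expShortfall_cdf_le_tailObjective (hα₀ : 0 < α) (hα₁ : α < 1)
    (hq : Integrable (fun x => max (x - q) 0) μ) :
    expShortfall α (cdf μ) ≤ tailObjective α μ q := by
  rw [expShortfall_cdf_eq_tailObjective hα₀ hα₁ hq]
  have hIci := le_measureReal_Ici_of_le_valueAtRisk_cdf μ (sub_pos.2 hα₁)
    (sub_lt_self 1 hα₀) le_rfl
  have hIoi := (valueAtRisk_cdf_le_iff_measureReal_Ioi_le μ (sub_pos.2 hα₁)
    (sub_lt_self 1 hα₀)).1 le_rfl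
  simpa using tailObjective_sub_le hα₀ (δ := 0) (integrable_max_sub hq _)
    (by linarith) (by linarith) q

end TailObjective

/-- The tail probabilities of `ν` near the level `q` are what they would be if `q` were the
`(1 - α)`-quantile, with tolerance `η` for the level and `δ` for the probability. -/
structure TailsNear (ν : Measure ℝ) (α q η δ : ℝ) : Prop where
  measureReal_Ioi_add_lt : ν.real (Ioi (q + η)) < α
  lt_measureReal_Ici_sub : α < ν.real (Ici (q - η))
  sub_lt_measureReal_Ici : α - δ < ν.real (Ici q)
  measureReal_Ioi_lt_add : ν.real (Ioi q) < α + δ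

theorem TailsNear.abs_expShortfall_sub_tailObjective_le {ν : Measure ℝ} [IsProbabilityMeasure ν]
    {α q η δ : ℝ} (h : TailsNear ν α q η δ) (hα₀ : 0 < α) (hα₁ : α < 1) (hδ : 0 ≤ δ)
    (hq : Integrable (fun x => max (x - q) 0) ν) :
    |expShortfall α (cdf ν) - tailObjective α ν q| ≤ η * (δ / α) := by
  have hupper : valueAtRisk (cdf ν) (1 - α) ≤ q + η :=
    (valueAtRisk_cdf_le_iff_measureReal_Ioi_le ν (sub_pos.2 hα₁) (sub_lt_self 1 hα₀)).2
      (by linarith [h.measureReal_Ioi_add_lt])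
  have hlower : q - η ≤ valueAtRisk (cdf ν) (1 - α) :=
    le_valueAtRisk_cdf_of_lt_measureReal_Ici ν (sub_lt_self 1 hα₀)
      (by linarith [h.lt_measureReal_Ici_sub])
  have hdist : |valueAtRisk (cdf ν) (1 - α) - q| ≤ η :=
    abs_le.2 ⟨by linarith, by linarith⟩
  have hle := tailObjective_sub_le hα₀ hq h.sub_lt_measureReal_Ici.le h.measureReal_Ioi_lt_add.le
    (valueAtRisk (cdf ν) (1 - α))
  rw [← expShortfall_cdf_eq_tailObjective hα₀ hα₁ hq] at hle
  rw [abs_sub_comm, abs_of_nonneg (sub_nonneg.2 (expShortfall_cdf_le_tailObjective hα₀ hα₁ hq))]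
  linarith [mul_le_mul_of_nonneg_right hdist (div_nonneg hδ hα₀.le)]

section HoeffdingVariance

theorem lintegral_measure_lt_eq {β : Type*} [MeasurableSpace β] (μ : Measure ℝ) [SFinite μ]
    (ν : Measure β) [SFinite ν] {g : β → ℝ} (hg : Measurable g) :
    ∫⁻ x, ν {b | g b < x} ∂μ = ∫⁻ b, μ (Ioi (g b)) ∂ν := by
  have hS : MeasurableSet {p : ℝ × β | g p.2 < p.1} :=
    measurableSet_lt (hg.comp measurable_snd) measurable_fst
  exact (Measure.prod_apply hS).symm.trans (Measure.prod_apply_symm hS)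

theorem volume_restrict_Ioi_Iio (q x : ℝ) :
    volume.restrict (Ioi q) (Iio x) = ENNReal.ofReal (max (x - q) 0) := by
  rw [Measure.restrict_apply measurableSet_Iio, Iio_inter_Ioi, Real.volume_Ioo,
    ENNReal.ofReal_max, ENNReal.ofReal_zero, max_eq_left zero_le]

theorem lintegral_ofReal_max_sub (μ : Measure ℝ) [SFinite μ] (q : ℝ) :
    ∫⁻ x, ENNReal.ofReal (max (x - q) 0) ∂μ = ∫⁻ t in Ioi q, μ (Ioi t) := by
  simp_rw [← volume_restrict_Ioi_Iio q]
  exact lintegral_measure_lt_eq μ _ measurable_id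

theorem lintegral_ofReal_max_sub_sq (μ : Measure ℝ) [SFinite μ] (q : ℝ) :
    ∫⁻ x, ENNReal.ofReal (max (x - q) 0) ^ 2 ∂μ =
      ∫⁻ t in Ioi q, ∫⁻ s in Ioi q, μ (Ioi (max t s)) := by
  have hmax : Measurable fun p : ℝ × ℝ => max p.1 p.2 := measurable_fst.max measurable_snd
  have hsq : ∀ x, ((volume.restrict (Ioi q)).prod (volume.restrict (Ioi q)))
      {p | max p.1 p.2 < x} = ENNReal.ofReal (max (x - q) 0) ^ 2 := fun x => by
    have hprod : {p : ℝ × ℝ | max p.1 p.2 < x} = Iio x ×ˢ Iio x := by ext; simp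
    rw [hprod, Measure.prod_prod, volume_restrict_Ioi_Iio, sq]
  have hanti : Antitone fun t => μ (Ioi t) := fun _ _ h => measure_mono (Ioi_subset_Ioi h)
  simp_rw [← hsq]
  rw [lintegral_measure_lt_eq μ _ hmax]
  exact lintegral_prod _ (hanti.measurable.comp hmax).aemeasurable

variable (μ : Measure ℝ) [IsProbabilityMeasure μ]

/-- Hoeffding's double integral for the variance of `(X - q)₊`, where `X` has distribution
function `F`. It is `[0, ∞]`-valued so that no integrability is presupposed. -/
noncomputable def hoeffdingVariance (F : ℝ → ℝ) (q : ℝ) : ℝ≥0∞ :=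
  ∫⁻ t in Ioi q, ∫⁻ s in Ioi q, ENNReal.ofReal (F (min t s) - F t * F s)

theorem ofReal_cdf_min_sub_mul (t s : ℝ) :
    ENNReal.ofReal (cdf μ (min t s) - cdf μ t * cdf μ s) =
      ENNReal.ofReal (cdf μ (min t s)) * μ (Ioi (max t s)) := by
  rw [measure_Ioi_eq_ofReal_one_sub_cdf, ← ENNReal.ofReal_mul (cdf_nonneg μ _)]
  rw [mul_one_sub, (monotone_cdf μ).map_min, (monotone_cdf μ).map_max, min_mul_max]

theorem ofReal_cdf_min_sub_mul_add (t s : ℝ) :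
    ENNReal.ofReal (cdf μ (min t s) - cdf μ t * cdf μ s) + μ (Ioi t) * μ (Ioi s) =
      μ (Ioi (max t s)) := by
  have hnonneg : ∀ r, 0 ≤ 1 - cdf μ r := fun r => sub_nonneg.2 (cdf_le_one μ r)
  rw [ofReal_cdf_min_sub_mul]
  simp_rw [measure_Ioi_eq_ofReal_one_sub_cdf]
  rw [← ENNReal.ofReal_mul (cdf_nonneg μ _), ← ENNReal.ofReal_mul (hnonneg t),
    ← ENNReal.ofReal_add (mul_nonneg (cdf_nonneg μ _) (hnonneg _))
      (mul_nonneg (hnonneg t) (hnonneg s))]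
  rw [(monotone_cdf μ).map_min, (monotone_cdf μ).map_max]
  congr 1
  linear_combination min_add_max (cdf μ t) (cdf μ s) - min_mul_max (cdf μ t) (cdf μ s)

theorem hoeffdingVariance_cdf_add_sq (q : ℝ) :
    hoeffdingVariance (cdf μ) q + (∫⁻ x, ENNReal.ofReal (max (x - q) 0) ∂μ) ^ 2 =
      ∫⁻ x, ENNReal.ofReal (max (x - q) 0) ^ 2 ∂μ := by
  have hanti : Antitone fun t => μ (Ioi t) := fun _ _ h => measure_mono (Ioi_subset_Ioi h)
  have hmeas := hanti.measurable
  rw [lintegral_ofReal_max_sub, lintegral_ofReal_max_sub_sq, hoeffdingVariance]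
  simp_rw [← ofReal_cdf_min_sub_mul_add, lintegral_add_right _ (hmeas.const_mul _),
    lintegral_const_mul _ hmeas]
  rw [lintegral_add_right _ (hmeas.mul_const _), lintegral_mul_const _ hmeas, sq]

theorem ofReal_cdf_mul_le_hoeffdingVariance (q : ℝ) :
    ENNReal.ofReal (cdf μ q) * ∫⁻ x, ENNReal.ofReal (max (x - q) 0) ^ 2 ∂μ ≤
      hoeffdingVariance (cdf μ) q := by
  rw [lintegral_ofReal_max_sub_sq, ← lintegral_const_mul' _ _ ENNReal.ofReal_ne_top]
  refine setLIntegral_mono' measurableSet_Ioi fun t ht => ?_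
  rw [← lintegral_const_mul' _ _ ENNReal.ofReal_ne_top]
  refine setLIntegral_mono' measurableSet_Ioi fun s hs => ?_
  rw [ofReal_cdf_min_sub_mul]
  gcongr
  exact le_min (le_of_lt ht) (le_of_lt hs)

variable {μ}

theorem memLp_two_max_sub {q : ℝ} (hq : 0 < cdf μ q)
    (hfin : hoeffdingVariance (cdf μ) q ≠ ∞) : MemLp (fun x => max (x - q) 0) 2 μ := by
  have hsq : ∫⁻ x, ENNReal.ofReal (max (x - q) 0) ^ 2 ∂μ < ∞ :=
    ENNReal.lt_top_of_mul_ne_top_right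
      (ne_top_of_le_ne_top hfin (ofReal_cdf_mul_le_hoeffdingVariance μ q)) (by simpa using hq)
  rw [memLp_two_iff_integrable_sq (by fun_prop)]
  refine ⟨by fun_prop, ?_⟩
  simpa only [hasFiniteIntegral_iff_ofReal (Eventually.of_forall fun _ => sq_nonneg _),
    ENNReal.ofReal_pow (le_max_right _ (0 : ℝ))] using hsq

theorem variance_max_sub_eq_hoeffdingVariance {q : ℝ}
    (hLp : MemLp (fun x => max (x - q) 0) 2 μ) :
    Var[fun x => max (x - q) 0; μ] = (hoeffdingVariance (cdf μ) q).toReal := by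
  have hnonneg : ∀ x : ℝ, 0 ≤ max (x - q) 0 := fun x => le_max_right _ _
  have hmean : ENNReal.ofReal (μ[fun x => max (x - q) 0]) =
      ∫⁻ x, ENNReal.ofReal (max (x - q) 0) ∂μ :=
    ofReal_integral_eq_lintegral_ofReal (hLp.integrable one_le_two)
      (Eventually.of_forall hnonneg)
  have hsq : ENNReal.ofReal (μ[(fun x => max (x - q) 0) ^ 2]) =
      ∫⁻ x, ENNReal.ofReal (max (x - q) 0) ^ 2 ∂μ := by
    simp_rw [← ENNReal.ofReal_pow (hnonneg _)]
    exact ofReal_integral_eq_lintegral_ofReal hLp.integrable_sq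
      (Eventually.of_forall fun x => sq_nonneg _)
  have hsum := hoeffdingVariance_cdf_add_sq μ q
  rw [← hmean, ← hsq, ← ENNReal.ofReal_pow (integral_nonneg hnonneg)] at hsum
  rw [variance_eq_sub hLp, ENNReal.eq_sub_of_add_eq ENNReal.ofReal_ne_top hsum,
    ← ENNReal.ofReal_sub _ (sq_nonneg _), ENNReal.toReal_ofReal]
  exact (variance_eq_sub hLp).symm ▸ variance_nonneg _ μ

section EsVariance

variable {α : ℝ}

theorem hoeffdingVariance_valueAtRisk_ne_top {F : ℝ → ℝ} (hα₀ : 0 < α) (hσ : esVariance α F ≠ ∞) :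
    hoeffdingVariance F (valueAtRisk F (1 - α)) ≠ ∞ :=
  (ENNReal.lt_top_of_mul_ne_top_right hσ (by simpa using hα₀.ne')).ne

theorem memLp_two_max_sub_valueAtRisk (hα₀ : 0 < α) (hα₁ : α < 1)
    (hσ : esVariance α (cdf μ) ≠ ∞) :
    MemLp (fun x => max (x - valueAtRisk (cdf μ) (1 - α)) 0) 2 μ :=
  memLp_two_max_sub ((sub_pos.2 hα₁).trans_le (le_cdf_valueAtRisk μ (sub_lt_self 1 hα₀)))
    (hoeffdingVariance_valueAtRisk_ne_top hα₀ hσ)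

theorem variance_max_sub_valueAtRisk (hα₀ : 0 < α) (hα₁ : α < 1)
    (hσ : esVariance α (cdf μ) ≠ ∞) :
    Var[fun x => max (x - valueAtRisk (cdf μ) (1 - α)) 0; μ] =
      α ^ 2 * esStdDev α (cdf μ) ^ 2 := by
  have hES : esVariance α (cdf μ) = ENNReal.ofReal (1 / α ^ 2) *
    hoeffdingVariance (cdf μ) (valueAtRisk (cdf μ) (1 - α)) := rfl
  rw [variance_max_sub_eq_hoeffdingVariance (memLp_two_max_sub_valueAtRisk hα₀ hα₁ hσ), esStdDev,
    Real.sq_sqrt ENNReal.toReal_nonneg, hES, ENNReal.toReal_mul,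
    ENNReal.toReal_ofReal (by positivity)]
  field_simp

end EsVariance

end HoeffdingVariance

section EmpiricalMeasure

variable {κ : Type*} [Fintype κ]

/-- The empirical measure `(1/m) ∑ᵢ δ_{xᵢ}` of a finite sample; the plug-in estimator is the
expected shortfall of this measure. -/
noncomputable def empiricalMeasure {E : Type*} [MeasurableSpace E] (x : κ → E) : Measure E :=
  (Fintype.card κ : ℝ≥0∞)⁻¹ • ∑ i, Measure.dirac (x i)

section General

variable {E : Type*} [MeasurableSpace E] (x : κ → E)

instance isProbabilityMeasure_empiricalMeasure [Nonempty κ] :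
    IsProbabilityMeasure (empiricalMeasure x) where
  measure_univ := by
    simp [empiricalMeasure, ENNReal.inv_mul_cancel]

variable [MeasurableSingletonClass E]

theorem integrable_empiricalMeasure [Nonempty κ] (f : E → ℝ) :
    Integrable f (empiricalMeasure x) :=
  (integrable_finsetSum_measure.2 fun _ _ => integrable_dirac (by simp)).smul_measure (by simp)

theorem integral_empiricalMeasure (f : E → ℝ) :
    ∫ y, f y ∂empiricalMeasure x = (Fintype.card κ : ℝ)⁻¹ * ∑ i, f (x i) := by
  rw [empiricalMeasure, integral_smul_measure,
    integral_finsetSum_measure fun i _ => integrable_dirac (by simp)]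
  simp

end General

theorem plugIn_eq_expShortfall_cdf {ι : Type*} (α : ℝ) {I : Finset ι} (hI : I.Nonempty)
    (x : ι → ℝ) :
    plugIn α I x = expShortfall α (cdf (empiricalMeasure fun i : I => x i)) := by
  have := hI.to_subtype
  rw [plugIn]
  congr 1
  ext t
  rw [cdf_eq_real, ← integral_indicator_one measurableSet_Iic, integral_empiricalMeasure,
    Finset.sum_coe_sort I fun i => (Iic t).indicator (1 : ℝ → ℝ) (x i)]
  simp [empDistFun, Pi.one_def]

variable [Nonempty κ] {α : ℝ}

theorem tailObjective_empiricalMeasure_le (hα₀ : 0 < α) (q : ℝ) (x y : κ → ℝ) :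
    tailObjective α (empiricalMeasure x) q ≤
      tailObjective α (empiricalMeasure y) q + 1 / α * dist x y := by
  have hterm : ∀ i, max (x i - q) 0 ≤ max (y i - q) 0 + dist x y := fun i => by
    have hi := (le_abs_self _).trans (dist_le_pi_dist x y i)
    refine max_le ?_ (add_nonneg (le_max_right _ _) dist_nonneg)
    linarith [le_max_left (y i - q) 0]
  have hsum : ∑ i, max (x i - q) 0 ≤ ∑ i, max (y i - q) 0 + Fintype.card κ * dist x y := by
    simpa [Finset.sum_add_distrib] using Finset.sum_le_sum fun i (_ : i ∈ Finset.univ) => hterm i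
  have hcard : (0 : ℝ) < Fintype.card κ := by exact_mod_cast Fintype.card_pos
  rw [tailObjective, tailObjective, integral_empiricalMeasure, integral_empiricalMeasure,
    add_assoc, ← mul_add]
  gcongr
  rw [inv_mul_le_iff₀ hcard, mul_add, mul_inv_cancel_left₀ hcard.ne']
  exact hsum

theorem lipschitzWith_expShortfall_empiricalMeasure (hα₀ : 0 < α) (hα₁ : α < 1) :
    LipschitzWith (1 / α).toNNReal
      fun x : κ → ℝ => expShortfall α (cdf (empiricalMeasure x)) := by
  refine LipschitzWith.of_le_add_mul' _ fun x y => ?_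
  rw [expShortfall_cdf_eq_tailObjective hα₀ hα₁
    (integrable_empiricalMeasure y fun t => max (t - 0) 0)]
  exact (expShortfall_cdf_le_tailObjective hα₀ hα₁ (integrable_empiricalMeasure x _)).trans
    (tailObjective_empiricalMeasure_le hα₀ _ x y)

end EmpiricalMeasure

section Concentration

variable {Ω : Type*} [MeasurableSpace Ω] {P : Measure Ω} {κ : Type*} [Fintype κ]

section Chebyshev

variable {E : Type*} [MeasurableSpace E] [MeasurableSingletonClass E] {μ : Measure E}
  {X : κ → Ω → E}

theorem memLp_integral_empiricalMeasure (hlaw : ∀ i, HasLaw (X i) μ P) {f : E → ℝ} {p : ℝ≥0∞}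
    (hf : MemLp f p μ) :
    MemLp (fun ω => ∫ y, f y ∂empiricalMeasure fun i => X i ω) p P := by
  simp_rw [integral_empiricalMeasure]
  have hterm : ∀ i, MemLp (fun ω => f (X i ω)) p P := fun i =>
    MemLp.comp_of_map ((hlaw i).map_eq.symm ▸ hf) (hlaw i).aemeasurable
  exact (memLp_finsetSum _ fun i _ => hterm i).const_mul _

variable [Nonempty κ]

theorem integral_integral_empiricalMeasure (hlaw : ∀ i, HasLaw (X i) μ P) {f : E → ℝ}
    (hf : Integrable f μ) :
    ∫ ω, (∫ y, f y ∂empiricalMeasure fun i => X i ω) ∂P = ∫ y, f y ∂μ := by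
  have hint : ∀ i, Integrable (fun ω => f (X i ω)) P := fun i =>
    Integrable.comp_aemeasurable ((hlaw i).map_eq.symm ▸ hf) (hlaw i).aemeasurable
  have hmean : ∀ i, ∫ ω, f (X i ω) ∂P = ∫ y, f y ∂μ := fun i =>
    (hlaw i).integral_comp hf.aestronglyMeasurable
  simp_rw [integral_empiricalMeasure]
  rw [integral_const_mul, integral_finsetSum _ fun i _ => hint i]
  simp [hmean]

theorem variance_integral_empiricalMeasure (hlaw : ∀ i, HasLaw (X i) μ P)
    (hind : Pairwise fun i j => IndepFun (X i) (X j) P) {f : E → ℝ} (hfm : Measurable f)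
    (hf : MemLp f 2 μ) :
    Var[fun ω => ∫ y, f y ∂empiricalMeasure fun i => X i ω; P] =
      Var[f; μ] / Fintype.card κ := by
  have hmem : ∀ i, MemLp (f ∘ X i) 2 P := fun i =>
    MemLp.comp_of_map ((hlaw i).map_eq.symm ▸ hf) (hlaw i).aemeasurable
  have hvar : ∀ i, Var[f ∘ X i; P] = Var[f; μ] := fun i => by
    rw [← (hlaw i).map_eq, variance_map hfm.aemeasurable (hlaw i).aemeasurable]
  have hsum : Var[∑ i, f ∘ X i; P] = Fintype.card κ * Var[f; μ] := by
    rw [IndepFun.variance_sum (fun i _ => hmem i)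
      fun i _ j _ hij => (hind hij).comp hfm hfm]
    simp [hvar]
  have hmean : (fun ω => ∫ y, f y ∂empiricalMeasure fun i => X i ω) =
      fun ω => (Fintype.card κ : ℝ)⁻¹ * (∑ i, f ∘ X i) ω := by
    ext ω
    simp [integral_empiricalMeasure]
  rw [hmean, variance_const_mul, hsum]
  field_simp

theorem measureReal_abs_integral_empiricalMeasure_sub_ge_le [IsFiniteMeasure P]
    (hlaw : ∀ i, HasLaw (X i) μ P) (hind : Pairwise fun i j => IndepFun (X i) (X j) P)
    {f : E → ℝ} (hfm : Measurable f) (hf : MemLp f 2 μ) {c : ℝ} (hc : 0 < c) :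
    P.real {ω | c ≤ |∫ y, f y ∂(empiricalMeasure fun i => X i ω) - ∫ y, f y ∂μ|} ≤
      Var[f; μ] / (Fintype.card κ * c ^ 2) := by
  have := (hlaw (Classical.arbitrary κ)).isFiniteMeasure_iff.1 inferInstance
  have hcheb := meas_ge_le_variance_div_sq (memLp_integral_empiricalMeasure hlaw hf) hc
  rw [integral_integral_empiricalMeasure hlaw (hf.integrable one_le_two),
    variance_integral_empiricalMeasure hlaw hind hfm hf, div_div] at hcheb
  exact ENNReal.toReal_le_of_le_ofReal (div_nonneg (variance_nonneg _ _) (by positivity)) hcheb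

end Chebyshev

section Frequency

theorem variance_indicator_one_le {E : Type*} [MeasurableSpace E] (μ : Measure E)
    [IsProbabilityMeasure μ] {S : Set E} (hS : MeasurableSet S) :
    Var[S.indicator (1 : E → ℝ); μ] ≤ μ.real S := by
  have hmem : ∀ᵐ x ∂μ, S.indicator (1 : E → ℝ) x ∈ Icc 0 1 := Eventually.of_forall fun x => by
    by_cases hx : x ∈ S <;> simp [hx]
  have hle := variance_le_sub_mul_sub hmem (measurable_one.indicator hS).aemeasurable
  rw [integral_indicator_one hS, sub_zero] at hle
  exact hle.trans (mul_le_of_le_one_left measureReal_nonneg (sub_le_self _ measureReal_nonneg))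

variable [Nonempty κ] {E : Type*} [MeasurableSpace E] [MeasurableSingletonClass E]
  [IsFiniteMeasure P] {μ : Measure E} [IsProbabilityMeasure μ] {X : κ → Ω → E} {S : Set E} {a δ : ℝ}

theorem measureReal_abs_frequency_sub_ge_le (hlaw : ∀ i, HasLaw (X i) μ P)
    (hind : Pairwise fun i j => IndepFun (X i) (X j) P) (hS : MeasurableSet S) (hδ : 0 < δ) :
    P.real {ω | δ ≤ |(empiricalMeasure fun i => X i ω).real S - μ.real S|} ≤
      μ.real S / (Fintype.card κ * δ ^ 2) := by
  have hcheb := measureReal_abs_integral_empiricalMeasure_sub_ge_le hlaw hind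
    (measurable_one.indicator hS) (memLp_indicator_const 2 hS 1 (Or.inr (measure_ne_top _ _))) hδ
  simp_rw [integral_indicator_one hS] at hcheb
  refine hcheb.trans ?_
  gcongr
  exact variance_indicator_one_le μ hS

theorem measureReal_add_le_frequency_le (hlaw : ∀ i, HasLaw (X i) μ P)
    (hind : Pairwise fun i j => IndepFun (X i) (X j) P) (hS : MeasurableSet S) (hδ : 0 < δ)
    (ha : μ.real S ≤ a) :
    P.real {ω | a + δ ≤ (empiricalMeasure fun i => X i ω).real S} ≤
      a / (Fintype.card κ * δ ^ 2) := by
  calc P.real {ω | a + δ ≤ (empiricalMeasure fun i => X i ω).real S}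
      ≤ P.real {ω | δ ≤ |(empiricalMeasure fun i => X i ω).real S - μ.real S|} := by
        refine measureReal_mono fun ω hω => ?_
        rw [mem_ofPred_eq] at hω ⊢
        exact le_abs.2 (Or.inl (by linarith))
    _ ≤ μ.real S / (Fintype.card κ * δ ^ 2) :=
        measureReal_abs_frequency_sub_ge_le hlaw hind hS hδ
    _ ≤ a / (Fintype.card κ * δ ^ 2) := by gcongr

theorem measureReal_frequency_le_sub_le (hlaw : ∀ i, HasLaw (X i) μ P)
    (hind : Pairwise fun i j => IndepFun (X i) (X j) P) (hS : MeasurableSet S) (hδ : 0 < δ)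
    (hδa : δ ≤ 2 * a) (ha : a ≤ μ.real S) :
    P.real {ω | (empiricalMeasure fun i => X i ω).real S ≤ a - δ} ≤
      a / (Fintype.card κ * δ ^ 2) := by
  have hgap : 0 < μ.real S - a + δ := by linarith
  have hratio : μ.real S / (μ.real S - a + δ) ^ 2 ≤ a / δ ^ 2 := by
    rw [div_le_div_iff₀ (by positivity) (by positivity)]
    nlinarith [mul_nonneg (sub_nonneg.2 ha) (mul_nonneg hδ.le (sub_nonneg.2 hδa)),
      mul_nonneg (by linarith : 0 ≤ a) (sq_nonneg (μ.real S - a))]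
  calc P.real {ω | (empiricalMeasure fun i => X i ω).real S ≤ a - δ}
      ≤ P.real {ω | μ.real S - a + δ ≤
          |(empiricalMeasure fun i => X i ω).real S - μ.real S|} := by
        refine measureReal_mono fun ω hω => ?_
        rw [mem_ofPred_eq] at hω ⊢
        exact le_abs.2 (Or.inr (by linarith))
    _ ≤ μ.real S / (Fintype.card κ * (μ.real S - a + δ) ^ 2) :=
        measureReal_abs_frequency_sub_ge_le hlaw hind hS hgap
    _ ≤ a / (Fintype.card κ * δ ^ 2) := by
        rw [mul_comm, ← div_div, mul_comm, ← div_div]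
        gcongr

end Frequency

end Concentration

section BlockEstimate

variable {Ω : Type*} [MeasurableSpace Ω] {P : Measure Ω} [IsFiniteMeasure P] {κ : Type*}
  [Fintype κ] [Nonempty κ] {μ : Measure ℝ} [IsProbabilityMeasure μ] {X : κ → Ω → ℝ}
  {α δ η r : ℝ}

theorem measureReal_not_tailsNear_le (hlaw : ∀ i, HasLaw (X i) μ P)
    (hind : Pairwise fun i j => IndepFun (X i) (X j) P) (hδ₀ : 0 < δ) (hδα : δ < α)
    (hδ₁ : α + δ < 1)
    (hupper : valueAtRisk (cdf μ) (1 - α + δ) ≤ valueAtRisk (cdf μ) (1 - α) + η)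
    (hlower : valueAtRisk (cdf μ) (1 - α) - η ≤ valueAtRisk (cdf μ) (1 - α - δ)) :
    P.real {ω | ¬ TailsNear (empiricalMeasure fun i => X i ω) α
        (valueAtRisk (cdf μ) (1 - α)) η δ} ≤ 4 * α / (Fintype.card κ * δ ^ 2) := by
  set q := valueAtRisk (cdf μ) (1 - α) with hq
  set ν : Ω → Measure ℝ := fun ω => empiricalMeasure fun i => X i ω
  have hsub : {ω | ¬ TailsNear (ν ω) α q η δ} ⊆
      ({ω | (α - δ) + δ ≤ (ν ω).real (Ioi (q + η))} ∪
        {ω | (ν ω).real (Ici (q - η)) ≤ (α + δ) - δ}) ∪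
      ({ω | (ν ω).real (Ici q) ≤ α - δ} ∪ {ω | α + δ ≤ (ν ω).real (Ioi q)}) := by
    intro ω hω
    contrapose! hω
    simp only [mem_union, mem_ofPred_eq, not_or, not_le, sub_add_cancel,
      add_sub_cancel_right] at hω
    exact not_not.2 ⟨hω.1.1, hω.1.2, hω.2.1, hω.2.2⟩
  have hIoi_upper := (valueAtRisk_cdf_le_iff_measureReal_Ioi_le μ (by linarith)
    (by linarith)).1 hupper
  have hIci_lower := le_measureReal_Ici_of_le_valueAtRisk_cdf μ (by linarith) (by linarith) hlower
  have hIoi := (valueAtRisk_cdf_le_iff_measureReal_Ioi_le μ (by linarith) (by linarith)).1 hq.ge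
  have hIci := le_measureReal_Ici_of_le_valueAtRisk_cdf μ (by linarith) (by linarith) hq.le
  have htail₁ := measureReal_add_le_frequency_le hlaw hind measurableSet_Ioi hδ₀
    (show μ.real (Ioi (q + η)) ≤ α - δ by linarith)
  have htail₂ := measureReal_frequency_le_sub_le hlaw hind measurableSet_Ici hδ₀ (by linarith)
    (show α + δ ≤ μ.real (Ici (q - η)) by linarith)
  have htail₃ := measureReal_frequency_le_sub_le hlaw hind measurableSet_Ici hδ₀ (by linarith)
    (show α ≤ μ.real (Ici q) by linarith)
  have htail₄ := measureReal_add_le_frequency_le hlaw hind measurableSet_Ioi hδ₀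
    (show μ.real (Ioi q) ≤ α by linarith)
  calc P.real {ω | ¬ TailsNear (ν ω) α q η δ}
      ≤ (α - δ) / (Fintype.card κ * δ ^ 2) + (α + δ) / (Fintype.card κ * δ ^ 2) +
        (α / (Fintype.card κ * δ ^ 2) + α / (Fintype.card κ * δ ^ 2)) :=
        (measureReal_mono hsub).trans <| (measureReal_union_le _ _).trans <| add_le_add
          ((measureReal_union_le _ _).trans (add_le_add htail₁ htail₂))
          ((measureReal_union_le _ _).trans (add_le_add htail₃ htail₄))
    _ = 4 * α / (Fintype.card κ * δ ^ 2) := by ring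

theorem measureReal_abs_tailObjective_sub_ge_le (hlaw : ∀ i, HasLaw (X i) μ P)
    (hind : Pairwise fun i j => IndepFun (X i) (X j) P) (hα₀ : 0 < α) (hα₁ : α < 1)
    (hσ : esVariance α (cdf μ) ≠ ∞) (hr : 0 < r) :
    P.real {ω | r ≤ |tailObjective α (empiricalMeasure fun i => X i ω)
        (valueAtRisk (cdf μ) (1 - α)) - tailObjective α μ (valueAtRisk (cdf μ) (1 - α))|} ≤
      esStdDev α (cdf μ) ^ 2 / (Fintype.card κ * r ^ 2) := by
  have hcheb := measureReal_abs_integral_empiricalMeasure_sub_ge_le hlaw hind (by fun_prop)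
    (memLp_two_max_sub_valueAtRisk hα₀ hα₁ hσ) (mul_pos hα₀ hr)
  rw [variance_max_sub_valueAtRisk hα₀ hα₁ hσ, mul_pow, mul_left_comm,
    mul_div_mul_left _ _ (by positivity)] at hcheb
  refine le_trans (measureReal_mono fun ω hω => ?_) hcheb
  rw [mem_ofPred_eq] at hω ⊢
  rwa [tailObjective, tailObjective, add_sub_add_left_eq_sub, ← mul_sub, abs_mul,
    abs_of_pos (one_div_pos.2 hα₀), one_div, ← div_eq_inv_mul, le_div_iff₀' hα₀] at hω

theorem measureReal_abs_expShortfall_sub_ge_le (hlaw : ∀ i, HasLaw (X i) μ P)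
    (hind : Pairwise fun i j => IndepFun (X i) (X j) P) (hσ : esVariance α (cdf μ) ≠ ∞)
    (hδ₀ : 0 < δ) (hδα : δ < α) (hδ₁ : α + δ < 1)
    (hupper : valueAtRisk (cdf μ) (1 - α + δ) ≤ valueAtRisk (cdf μ) (1 - α) + η)
    (hlower : valueAtRisk (cdf μ) (1 - α) - η ≤ valueAtRisk (cdf μ) (1 - α - δ)) (hr : 0 < r) :
    P.real {ω | r + η * (δ / α) ≤ |expShortfall α (cdf (empiricalMeasure fun i => X i ω)) -
        expShortfall α (cdf μ)|} ≤
      esStdDev α (cdf μ) ^ 2 / (Fintype.card κ * r ^ 2) +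
        4 * α / (Fintype.card κ * δ ^ 2) := by
  have hα₀ : 0 < α := hδ₀.trans hδα
  have hα₁ : α < 1 := by linarith
  rw [expShortfall_cdf_eq_tailObjective hα₀ hα₁
    ((memLp_two_max_sub_valueAtRisk hα₀ hα₁ hσ).integrable one_le_two)]
  refine (measureReal_mono fun ω hω => ?_).trans <| (measureReal_union_le _ _).trans <|
    add_le_add (measureReal_abs_tailObjective_sub_ge_le hlaw hind hα₀ hα₁ hσ hr)
      (measureReal_not_tailsNear_le hlaw hind hδ₀ hδα hδ₁ hupper hlower)
  by_contra! hgood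
  simp only [mem_union, mem_ofPred_eq, not_or, not_le, not_not] at hgood hω
  have hnear := hgood.2.abs_expShortfall_sub_tailObjective_le hα₀ hα₁ hδ₀.le
    (integrable_empiricalMeasure _ _)
  exact hω.not_gt <| (abs_sub_le _ _ _).trans_lt <| by
    rw [add_comm r]
    exact add_lt_add_of_le_of_lt hnear hgood.1

variable {L : ℝ≥0} {ε : ℝ}

theorem measureReal_abs_expShortfall_sub_ge_le_of_lipschitzOnWith
    (hlaw : ∀ i, HasLaw (X i) μ P) (hind : Pairwise fun i j => IndepFun (X i) (X j) P)
    (hα₁ : α < 1 / 2) (hσ : esVariance α (cdf μ) ≠ ∞)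
    (hL : LipschitzOnWith L (valueAtRisk (cdf μ)) (Icc (1 - 2 * α) (1 - α / 2)))
    (hδ₀ : 0 < δ) (hδα : δ ≤ α / 2) (hr : 0 < r) :
    P.real {ω | r + L * (δ ^ 2 / α) ≤
        |expShortfall α (cdf (empiricalMeasure fun i => X i ω)) - expShortfall α (cdf μ)|} ≤
      esStdDev α (cdf μ) ^ 2 / (Fintype.card κ * r ^ 2) +
        4 * α / (Fintype.card κ * δ ^ 2) := by
  have hmem : ∀ {u : ℝ}, |u - (1 - α)| ≤ δ → u ∈ Icc (1 - 2 * α) (1 - α / 2) := fun hu => by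
    constructor <;> linarith [abs_le.1 hu]
  have hdist : ∀ {u : ℝ}, |u - (1 - α)| = δ →
      |valueAtRisk (cdf μ) u - valueAtRisk (cdf μ) (1 - α)| ≤ L * δ := fun {u} hu => by
    have := hL.dist_le_mul u (hmem hu.le) (1 - α) (hmem (by simpa using hδ₀.le))
    rwa [Real.dist_eq, Real.dist_eq, hu] at this
  have hupper := abs_le.1 (hdist (u := 1 - α + δ) (by simp [hδ₀.le]))
  have hlower := abs_le.1 (hdist (u := 1 - α - δ) (by simp [hδ₀.le]))
  have hδsq : L * (δ ^ 2 / α) = L * δ * (δ / α) := by ring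
  rw [hδsq]
  exact measureReal_abs_expShortfall_sub_ge_le hlaw hind hσ hδ₀ (by linarith) (by linarith)
    (by linarith) (by linarith) hr

theorem measureReal_abs_expShortfall_sub_ge_le_one_eighth (hlaw : ∀ i, HasLaw (X i) μ P)
    (hind : Pairwise fun i j => IndepFun (X i) (X j) P) (hα₀ : 0 < α) (hα₁ : α < 1 / 2)
    (hσ : esVariance α (cdf μ) ≠ ∞)
    (hL : LipschitzOnWith L (valueAtRisk (cdf μ)) (Icc (1 - 2 * α) (1 - α / 2)))
    (hpos : 0 < L ∨ 0 < esStdDev α (cdf μ)) (hε₀ : 0 < ε) (hε₁ : ε < 1 / 8 * √α)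
    (hκ : 11 / ε ^ 2 ≤ Fintype.card κ) :
    P.real {ω | ε * esStdDev α (cdf μ) + 32 * L * ε ^ 2 ≤
        |expShortfall α (cdf (empiricalMeasure fun i => X i ω)) - expShortfall α (cdf μ)|} ≤
      1 / 8 := by
  set σ := esStdDev α (cdf μ)
  have hσ₀ : 0 ≤ σ := Real.sqrt_nonneg _
  have : 0 < √α := Real.sqrt_pos.2 hα₀
  have hcard : 11 ≤ Fintype.card κ * ε ^ 2 := (div_le_iff₀ (by positivity)).1 hκ
  have hr : 0 < ε * σ + 16 * L * ε ^ 2 := by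
    rcases hpos with hL₀ | hσ₀'
    · have : (0 : ℝ) < L := hL₀
      positivity
    · positivity
  have hδsq : (4 * √α * ε) ^ 2 = 16 * α * ε ^ 2 := by
    rw [mul_pow, mul_pow, Real.sq_sqrt hα₀.le]
    ring
  have hδα : 4 * √α * ε ≤ α / 2 := by nlinarith [Real.mul_self_sqrt hα₀.le]
  have hσ_term : σ ^ 2 / (Fintype.card κ * (ε * σ + 16 * L * ε ^ 2) ^ 2) ≤ 1 / 11 := by
    rw [div_le_div_iff₀ (by positivity) (by norm_num)]
    calc σ ^ 2 * 11 ≤ σ ^ 2 * (Fintype.card κ * ε ^ 2) := by gcongr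
      _ = Fintype.card κ * (ε * σ) ^ 2 := by ring
      _ ≤ 1 * (Fintype.card κ * (ε * σ + 16 * L * ε ^ 2) ^ 2) := by
        rw [one_mul]
        gcongr
        exact le_add_of_nonneg_right (by positivity)
  have hδ_term : 4 * α / (Fintype.card κ * (4 * √α * ε) ^ 2) ≤ 1 / 44 := by
    rw [hδsq, div_le_div_iff₀ (by positivity) (by norm_num)]
    nlinarith [mul_le_mul_of_nonneg_left hcard hα₀.le]
  have hthreshold : ε * σ + 16 * L * ε ^ 2 + L * ((4 * √α * ε) ^ 2 / α) =
      ε * σ + 32 * L * ε ^ 2 := by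
    rw [hδsq]
    field_simp
    ring
  have hbound := measureReal_abs_expShortfall_sub_ge_le_of_lipschitzOnWith hlaw hind hα₁ hσ hL
    (by positivity : 0 < 4 * √α * ε) hδα hr
  rw [hthreshold] at hbound
  linarith

end BlockEstimate

section IndependentBlocks

variable {Ω ι E : Type*} [MeasurableSpace Ω] {P : Measure Ω} [Countable ι] [MeasurableSpace E]

theorem iIndepFun_curry {κ : ι → Type*} [∀ i, Countable (κ i)] {X : (Σ i, κ i) → Ω → E}
    (hind : iIndepFun X P) (hX : ∀ p, AEMeasurable (X p) P) :
    iIndepFun (fun i ω (j : κ i) => X ⟨i, j⟩ ω) P := by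
  have := hind.isProbabilityMeasure
  have : ∀ i (j : κ i), IsProbabilityMeasure (P.map (X ⟨i, j⟩)) :=
    fun i j => Measure.isProbabilityMeasure_map (hX _)
  have hrow : ∀ i, P.map (fun ω (j : κ i) => X ⟨i, j⟩ ω) =
      Measure.infinitePi fun j => P.map (X ⟨i, j⟩) := fun i =>
    (hind.precomp sigma_mk_injective).map_fun_eq_infinitePi_map₀' fun j => hX ⟨i, j⟩
  have hcurry := Measure.infinitePi_map_piCurry (X := fun i (_ : κ i) => E)
    (fun i j => P.map (X ⟨i, j⟩))
  rw [← hind.map_fun_eq_infinitePi_map₀' hX, AEMeasurable.map_map_of_aemeasurable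
    (by fun_prop) (aemeasurable_pi_lambda _ hX)] at hcurry
  have hrow_meas : ∀ i, AEMeasurable (fun ω (j : κ i) => X ⟨i, j⟩ ω) P := fun i =>
    aemeasurable_pi_lambda _ fun j => hX ⟨i, j⟩
  rw [iIndepFun_iff_map_fun_eq_infinitePi_map₀' hrow_meas]
  simp_rw [hrow]
  exact hcurry

theorem iIndepFun_restrict_of_pairwise_disjoint {κ : Type*} [Countable κ] {X : ι → Ω → E}
    (hind : iIndepFun X P) (hX : ∀ i, AEMeasurable (X i) P) {I : κ → Finset ι}
    (hI : Pairwise fun j k => Disjoint (I j) (I k)) :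
    iIndepFun (fun j ω (i : I j) => X i ω) P := by
  have hinj : Function.Injective fun p : Σ j, I j => (p.2 : ι) := by
    rintro ⟨j, i, hi⟩ ⟨k, i', hi'⟩ (rfl : i = i')
    obtain rfl : j = k := by
      by_contra hjk
      exact Finset.disjoint_left.1 (hI hjk) hi hi'
    rfl
  exact iIndepFun_curry (X := fun p : Σ j, I j => X p.2) (hind.precomp hinj) fun p => hX p.2

end IndependentBlocks

section Blocks

variable {N m : ℕ}

theorem card_block {j : ℕ} (hj : j < N / m) : (block N m j).card = m := by
  have hle : (j + 1) * m ≤ N := (Nat.mul_le_mul_right m hj).trans (Nat.div_mul_le_self N m)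
  have hmap : (block N m j).map Fin.valEmbedding = Finset.Ico (j * m) ((j + 1) * m) := by
    ext i
    simp only [block, Finset.mem_map, Finset.mem_filter_univ, Fin.valEmbedding_apply,
      Finset.mem_Ico]
    exact ⟨fun ⟨_, hk, hki⟩ => hki ▸ hk, fun hi => ⟨⟨i, hi.2.trans_le hle⟩, hi, rfl⟩⟩
  rw [← Finset.card_map, hmap, Nat.card_Ico, add_mul, one_mul, Nat.add_sub_cancel_left]

theorem nonempty_block {j : ℕ} (hj : j < N / m) : (block N m j).Nonempty := by
  rw [← Finset.card_pos, card_block hj, Nat.pos_iff_ne_zero]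
  rintro rfl
  simp at hj

theorem disjoint_block {j k : ℕ} (hjk : j ≠ k) : Disjoint (block N m j) (block N m k) := by
  wlog hlt : j < k generalizing j k
  · exact (this hjk.symm (hjk.lt_or_gt.resolve_left hlt)).symm
  refine Finset.disjoint_left.2 fun i hij hik => ?_
  rw [block, Finset.mem_filter_univ] at hij hik
  exact (hij.2.trans_le (Nat.mul_le_mul_right m hlt)).not_ge hik.1

theorem numBlocks_bounds {ε : ℝ} (hε₀ : 0 < ε) (hε₁ : ε ≤ 1) (hN : 1212 / ε ^ 2 ≤ N) :
    100 ≤ numBlocks ε N ∧ N * ε ^ 2 ≤ 24 * numBlocks ε N := by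
  have hsize : blockSize ε * ε ^ 2 ≤ 12 := by
    calc blockSize ε * ε ^ 2 ≤ (11 / ε ^ 2 + 1) * ε ^ 2 := by
          gcongr
          exact (Nat.ceil_lt_add_one (by positivity)).le
      _ = 11 + ε ^ 2 := by field_simp
      _ ≤ 12 := by nlinarith
  have hcover : (N : ℝ) ≤ (numBlocks ε N + 1) * blockSize ε := by
    have hlt := Nat.lt_div_mul_add (Nat.ceil_pos.2 (by positivity) : 0 < blockSize ε) (a := N)
    rw [numBlocks, add_one_mul]
    exact_mod_cast hlt.le
  have hupper : N * ε ^ 2 ≤ (numBlocks ε N + 1) * 12 := by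
    calc N * ε ^ 2 ≤ (numBlocks ε N + 1) * blockSize ε * ε ^ 2 := by gcongr
      _ = (numBlocks ε N + 1) * (blockSize ε * ε ^ 2) := by ring
      _ ≤ (numBlocks ε N + 1) * 12 := by gcongr
  have hlower : 1212 ≤ N * ε ^ 2 := (div_le_iff₀ (by positivity)).1 hN
  have hn : (100 : ℝ) ≤ numBlocks ε N := by linarith
  exact ⟨by exact_mod_cast hn, by linarith⟩

end Blocks

section Hoeffding

variable {Ω ι E : Type*} [MeasurableSpace Ω] {P : Measure Ω} [Fintype ι] [MeasurableSpace E]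

theorem measureReal_add_mul_card_le_card_mem_le {T : ι → Ω → E} {S : Set E} {p t : ℝ}
    [DecidablePred (· ∈ S)] (hind : iIndepFun T P) (hT : ∀ i, AEMeasurable (T i) P)
    (hS : MeasurableSet S) (hp : ∀ i, P.real {ω | T i ω ∈ S} ≤ p) (ht : 0 ≤ t) :
    P.real {ω | (p + t) * Fintype.card ι ≤ (Finset.univ.filter fun i => T i ω ∈ S).card} ≤
      Real.exp (-2 * t ^ 2 * Fintype.card ι) := by
  have := hind.isProbabilityMeasure
  set n : ℝ := (Fintype.card ι : ℝ) with hn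
  set V : ι → Ω → ℝ := fun i ω => S.indicator 1 (T i ω) with hV
  have hVm : ∀ i, AEMeasurable (V i) P := fun i =>
    (measurable_one.indicator hS).comp_aemeasurable (hT i)
  have hmean : ∑ i, P[V i] ≤ p * n := by
    have hterm : ∀ i, P[V i] ≤ p := fun i => by
      refine le_trans (le_of_eq ?_) (hp i)
      rw [← integral_map (hT i) (measurable_one.indicator hS).aestronglyMeasurable,
        integral_indicator_one hS, map_measureReal_apply_of_aemeasurable (hT i) hS]
      rfl
    simpa [hn, mul_comm] using Finset.sum_le_sum fun i (_ : i ∈ Finset.univ) => hterm i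
  have hcount : ∀ ω, ((Finset.univ.filter fun i => T i ω ∈ S).card : ℝ) = ∑ i, V i ω := fun ω => by
    simp [hV, indicator_apply]
  have hsub : ∀ i ∈ Finset.univ, HasSubgaussianMGF (fun ω => V i ω - P[V i])
      ((‖(1 : ℝ) - 0‖₊ / 2) ^ 2) P := fun i _ =>
    hasSubgaussianMGF_of_mem_Icc (hVm i) (.of_forall fun ω =>
      ⟨indicator_nonneg (fun _ _ => zero_le_one) _, indicator_le_self' (fun _ _ => zero_le_one) _⟩)
  have hindV : iIndepFun (fun i ω => V i ω - P[V i]) P :=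
    hind.comp (fun i x => S.indicator 1 x - ∫ ω, V i ω ∂P) fun i =>
      (measurable_one.indicator hS).sub_const _
  have hhoeff := HasSubgaussianMGF.measure_sum_ge_le_of_iIndepFun hindV hsub
    (ε := t * n) (by positivity)
  refine (measureReal_mono fun ω hω => ?_).trans (hhoeff.trans_eq ?_)
  · rw [mem_ofPred_eq, hcount] at hω
    rw [mem_ofPred_eq, Finset.sum_sub_distrib]
    linarith
  · rcases eq_or_ne n 0 with hn₀ | hn₀
    · simp [hn₀]
    · simp only [sub_zero, nnnorm_one, Finset.sum_const, Finset.card_univ, nsmul_eq_mul]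
      congr 1
      push_cast
      rw [← hn]
      field_simp

end Hoeffding

section OrderStatistics

variable {n : ℕ} {T : Fin n → ℝ} {s : Set ℝ} [DecidablePred (· ∉ s)]

theorem orderStat_mem (hs : s.OrdConnected) {k : ℕ}
    (hk : (Finset.univ.filter fun j => T j ∉ s).card ≤ k)
    (hkn : k + (Finset.univ.filter fun j => T j ∉ s).card < n) : orderStat T k ∈ s := by
  have hk' : k < n := by omega
  have hmono := Tuple.monotone_sort T
  have exists_mem : ∀ J : Finset (Fin n), (Finset.univ.filter fun j => T j ∉ s).card < J.card →
      ∃ i ∈ J, T (Tuple.sort T i) ∈ s := fun J hJ => by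
    obtain ⟨j, hj, hjs⟩ := Finset.exists_mem_notMem_of_card_lt_card
      (hJ.trans_eq (Finset.card_map (Tuple.sort T).toEmbedding).symm)
    obtain ⟨i, hi, rfl⟩ := Finset.mem_map.1 hj
    exact ⟨i, hi, by simpa using hjs⟩
  obtain ⟨i, hi, his⟩ := exists_mem (Finset.Iic ⟨k, hk'⟩) (by rw [Fin.card_Iic]; simp only; omega)
  obtain ⟨l, hl, hls⟩ := exists_mem (Finset.Ici ⟨k, hk'⟩) (by rw [Fin.card_Ici]; simp only; omega)
  rw [orderStat, dif_pos hk']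
  exact hs.out his hls ⟨hmono (Finset.mem_Iic.1 hi), hmono (Finset.mem_Ici.1 hl)⟩

theorem interpQuantile_mem (hs : s.OrdConnected) {β : ℝ}
    (hlower : (Finset.univ.filter fun j => T j ∉ s).card ≤ ((n : ℝ) - 1) * β)
    (hupper : ((n : ℝ) - 1) * β + 1 + (Finset.univ.filter fun j => T j ∉ s).card < n) :
    interpQuantile T β ∈ s := by
  rw [interpQuantile]
  set h : ℝ := ((n : ℝ) - 1) * β
  have hfloor_le : (⌊h⌋₊ : ℝ) ≤ h := Nat.floor_le ((Nat.cast_nonneg _).trans hlower)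
  have hlt_floor : h < ⌊h⌋₊ + 1 := Nat.lt_floor_add_one h
  have hk : (Finset.univ.filter fun j => T j ∉ s).card ≤ ⌊h⌋₊ := Nat.le_floor hlower
  have hkn : ⌊h⌋₊ + 1 + (Finset.univ.filter fun j => T j ∉ s).card < n := by
    have : (⌊h⌋₊ : ℝ) + 1 + (Finset.univ.filter fun j => T j ∉ s).card < n := by linarith
    exact_mod_cast this
  have hleft : orderStat T ⌊h⌋₊ ∈ s := orderStat_mem hs hk (by omega)
  have hright : orderStat T (⌊h⌋₊ + 1) ∈ s := orderStat_mem hs (by omega) hkn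
  have hweight : h - ⌊h⌋₊ ∈ Icc (0 : ℝ) 1 := ⟨by linarith, by linarith⟩
  exact hs.convex.add_smul_sub_mem hleft hright hweight

end OrderStatistics

section Truncation

variable {α ε β₁ β₂ : ℝ} {s : Set ℝ}

theorem min_max_mem_of_ordConnected (hs : s.OrdConnected) {x y : ℝ} (hx : x ∈ s) (hy : y ∈ s)
    (t : ℝ) : min (max t x) y ∈ s := by
  rcases le_total y (max t x) with h | h
  · rwa [min_eq_right h]
  · rw [min_eq_left h]
    exact hs.out hx hy ⟨le_max_right _ _, h⟩

theorem truncatedEstimator_mem [DecidablePred (· ∉ s)] (hs : s.OrdConnected)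
    (hβ₁ : 0.35 ≤ β₁) (hβ : β₁ ≤ β₂) (hβ₂ : β₂ ≤ 0.65) {N : ℕ} {x : Fin N → ℝ}
    (hn : 100 ≤ numBlocks ε N)
    (hcard : (Finset.univ.filter fun j => blockEstimates α ε x j ∉ s).card <
      0.3 * (numBlocks ε N : ℝ)) :
    truncatedEstimator α ε β₁ β₂ x ∈ s := by
  have hn' : (100 : ℝ) ≤ numBlocks ε N := by exact_mod_cast hn
  have hquantile : ∀ β ∈ Icc (0.35 : ℝ) 0.65, interpQuantile (blockEstimates α ε x) β ∈ s :=
    fun β hβ => by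
      have hlower : ((numBlocks ε N : ℝ) - 1) * 0.35 ≤ (numBlocks ε N - 1) * β :=
        mul_le_mul_of_nonneg_left hβ.1 (by linarith)
      have hupper : ((numBlocks ε N : ℝ) - 1) * β ≤ (numBlocks ε N - 1) * 0.65 :=
        mul_le_mul_of_nonneg_left hβ.2 (by linarith)
      norm_num at hlower hupper hcard
      exact interpQuantile_mem hs (by linarith) (by linarith)
  exact min_max_mem_of_ordConnected hs (hquantile β₁ ⟨hβ₁, hβ.trans hβ₂⟩)
    (hquantile β₂ ⟨hβ₁.trans hβ, hβ₂⟩) _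

end Truncation

section Tail

variable {Ω : Type*} [MeasurableSpace Ω] {P : Measure Ω}

theorem distFun_eq_cdf [IsProbabilityMeasure P] {Y : Ω → ℝ} (hY : AEMeasurable Y P) :
    distFun P Y = cdf (P.map Y) := by
  have := Measure.isProbabilityMeasure_map hY
  ext t
  rw [cdf_eq_real, map_measureReal_apply_of_aemeasurable hY measurableSet_Iic]
  rfl

variable {μ : Measure ℝ} [IsProbabilityMeasure μ] {N : ℕ} {X : Fin N → Ω → ℝ} {α ε : ℝ} {L : ℝ≥0}

theorem blockEstimates_eq_expShortfall_cdf (α : ℝ) (x : Fin N → ℝ) (j : Fin (numBlocks ε N)) :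
    blockEstimates α ε x j =
      expShortfall α (cdf (empiricalMeasure fun i : block N (blockSize ε) j => x i)) :=
  plugIn_eq_expShortfall_cdf α (nonempty_block j.2) x

theorem measurable_blockEstimates (hα₀ : 0 < α) (hα₁ : α < 1) (j : Fin (numBlocks ε N)) :
    Measurable fun x : Fin N → ℝ => blockEstimates α ε x j := by
  have := (nonempty_block j.2).to_subtype
  simp_rw [blockEstimates_eq_expShortfall_cdf]
  exact (lipschitzWith_expShortfall_empiricalMeasure hα₀ hα₁).continuous.measurable.comp
    (measurable_pi_lambda _ fun i => measurable_pi_apply _)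

theorem iIndepFun_blockEstimates (hind : iIndepFun X P) (hX : ∀ i, AEMeasurable (X i) P)
    (hα₀ : 0 < α) (hα₁ : α < 1) :
    iIndepFun (fun (j : Fin (numBlocks ε N)) ω => blockEstimates α ε (fun i => X i ω) j) P := by
  simp_rw [blockEstimates_eq_expShortfall_cdf]
  have hdisj : Pairwise fun j k : Fin (numBlocks ε N) =>
      Disjoint (block N (blockSize ε) j) (block N (blockSize ε) k) := fun j k hjk =>
    disjoint_block (Fin.val_ne_of_ne hjk)
  exact (iIndepFun_restrict_of_pairwise_disjoint hind hX hdisj).comp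
    (fun j x => expShortfall α (cdf (empiricalMeasure x))) fun j =>
      have := (nonempty_block j.2).to_subtype
      (lipschitzWith_expShortfall_empiricalMeasure hα₀ hα₁).continuous.measurable

theorem measureReal_blockEstimates_notMem_ball_le [IsFiniteMeasure P]
    (hlaw : ∀ i, HasLaw (X i) μ P)
    (hind : Pairwise fun i j => IndepFun (X i) (X j) P) (hα₀ : 0 < α) (hα₁ : α < 1 / 2)
    (hσ : esVariance α (cdf μ) ≠ ∞)
    (hL : LipschitzOnWith L (valueAtRisk (cdf μ)) (Icc (1 - 2 * α) (1 - α / 2)))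
    (hpos : 0 < L ∨ 0 < esStdDev α (cdf μ)) (hε₀ : 0 < ε) (hε₁ : ε < 1 / 8 * √α)
    (j : Fin (numBlocks ε N)) :
    P.real {ω | blockEstimates α ε (fun i => X i ω) j ∉ Metric.ball (expShortfall α (cdf μ))
      (ε * esStdDev α (cdf μ) + 32 * L * ε ^ 2)} ≤ 1 / 8 := by
  have := (nonempty_block j.2).to_subtype
  simp_rw [blockEstimates_eq_expShortfall_cdf, Metric.mem_ball, Real.dist_eq, not_lt]
  refine measureReal_abs_expShortfall_sub_ge_le_one_eighth
    (X := fun i : block N (blockSize ε) j => X i) (fun i => hlaw i)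
    (fun i k hik => hind (Subtype.coe_ne_coe.2 hik)) hα₀ hα₁ hσ hL hpos hε₀ hε₁ ?_
  rw [Fintype.card_coe, card_block j.2]
  exact Nat.le_ceil _

variable {β₁ β₂ : ℝ}

theorem measureReal_abs_truncatedEstimator_sub_ge_le (hlaw : ∀ i, HasLaw (X i) μ P)
    (hind : iIndepFun X P) (hα₀ : 0 < α) (hα₁ : α < 1 / 2)
    (hβ₁ : 0.35 ≤ β₁) (hβ : β₁ ≤ β₂) (hβ₂ : β₂ ≤ 0.65) (hσ : esVariance α (cdf μ) ≠ ∞)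
    (hL : LipschitzOnWith L (valueAtRisk (cdf μ)) (Icc (1 - 2 * α) (1 - α / 2)))
    (hpos : 0 < L ∨ 0 < esStdDev α (cdf μ)) (hε₀ : 0 < ε) (hε₁ : ε < 1 / 8 * √α)
    (hN : 1212 / ε ^ 2 ≤ N) :
    P.real {ω | ε * esStdDev α (cdf μ) + 32 * L * ε ^ 2 ≤
        |truncatedEstimator α ε β₁ β₂ (fun i => X i ω) - expShortfall α (cdf μ)|} ≤
      Real.exp (-(1 / 400) * N * ε ^ 2) := by
  classical
  have := hind.isProbabilityMeasure
  set s := Metric.ball (expShortfall α (cdf μ)) (ε * esStdDev α (cdf μ) + 32 * L * ε ^ 2) with hs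
  have hX : ∀ i, AEMeasurable (X i) P := fun i => (hlaw i).aemeasurable
  have hsqrt : √α ≤ 1 := Real.sqrt_le_one.2 (by linarith)
  obtain ⟨hn, hNn⟩ := numBlocks_bounds hε₀ (by linarith) hN
  have hcount := measureReal_add_mul_card_le_card_mem_le (S := sᶜ) (t := 0.175)
    (iIndepFun_blockEstimates hind hX hα₀ (by linarith))
    (fun j => (measurable_blockEstimates hα₀ (by linarith) j).comp_aemeasurable
      (aemeasurable_pi_lambda _ hX)) Metric.isOpen_ball.measurableSet.compl
    (measureReal_blockEstimates_notMem_ball_le hlaw (fun i j hij => hind.indepFun hij) hα₀ hα₁ hσ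
      hL hpos hε₀ hε₁) (by norm_num)
  rw [Fintype.card_fin] at hcount
  refine (measureReal_mono fun ω hω => ?_).trans (hcount.trans (Real.exp_le_exp.2 ?_))
  · by_contra hfew
    rw [mem_ofPred_eq, not_le] at hfew
    have hmem : truncatedEstimator α ε β₁ β₂ (fun i => X i ω) ∈ s :=
      truncatedEstimator_mem (convex_ball _ _).ordConnected hβ₁ hβ hβ₂ hn
        (hfew.trans_eq (by norm_num))
    rw [hs, Metric.mem_ball, Real.dist_eq] at hmem
    exact hmem.not_ge hω
  · norm_num
    linarith

end Tail

end ExpShortfall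

theorem mainTheorem7 :
    ∃ c₀ c₁ c₂ c₃ : ℝ, 0 < c₀ ∧ 0 < c₁ ∧ 0 < c₂ ∧ 0 < c₃ ∧
      ∀ (Ω : Type*) [MeasurableSpace Ω] (P : Measure Ω) [IsProbabilityMeasure P]
        (α : ℝ) (_ : 0 < α) (_ : α < 1 / 2)
        (β₁ β₂ : ℝ) (_ : 0.35 ≤ β₁) (_ : β₁ ≤ β₂) (_ : β₂ ≤ 0.65)
        -- the loss `Y` and the i.i.d. sample `X` of size `N`
        (Y : Ω → ℝ) (N : ℕ) (X : Fin N → Ω → ℝ)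
        (_ : iIndepFun X P) (_ : ∀ i, IdentDistrib (X i) Y P P)
        (_ : ExpShortfall.esVariance α (ExpShortfall.distFun P Y) ≠ ∞)
        (L : ℝ≥0)
        (_ : LipschitzOnWith L (ExpShortfall.valueAtRisk (ExpShortfall.distFun P Y))
          (Set.Icc (1 - 2 * α) (1 - α / 2)))
        -- the error scales are not both zero
        (_ : 0 < L ∨ 0 < ExpShortfall.esStdDev α (ExpShortfall.distFun P Y))
        (ε : ℝ) (_ : 0 < ε) (_ : ε < c₀ * Real.sqrt α) (_ : c₁ / ε ^ 2 ≤ (N : ℝ)),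
        -- the constants are those of the general bound
        P.real {ω | ε * ExpShortfall.esStdDev α (ExpShortfall.distFun P Y) + c₂ * L * ε ^ 2 ≤
            |ExpShortfall.truncatedEstimator α ε β₁ β₂ (fun i => X i ω) -
              ExpShortfall.expShortfall α (ExpShortfall.distFun P Y)|}
          ≤ Real.exp (-c₃ * N * ε ^ 2) ∧
        -- the purely Gaussian bound; for `L > 0` the condition is `ε ≤ σ / (c₂ L)`
        (ε * (c₂ * L) ≤ ExpShortfall.esStdDev α (ExpShortfall.distFun P Y) →
          P.real {ω | 2 * ε * ExpShortfall.esStdDev α (ExpShortfall.distFun P Y) ≤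
              |ExpShortfall.truncatedEstimator α ε β₁ β₂ (fun i => X i ω) -
                ExpShortfall.expShortfall α (ExpShortfall.distFun P Y)|}
            ≤ Real.exp (-c₃ * N * ε ^ 2)) := by
  refine ⟨1 / 8, 1212, 32, 1 / 400, by norm_num, by norm_num, by norm_num, by norm_num, ?_⟩
  intro Ω _ P _ α hα₀ hα₁ β₁ β₂ hβ₁ hβ hβ₂ Y N X hind hid hσ L hL hpos ε hε₀ hε₁ hN
  have hN₀ : (0 : ℝ) < N := lt_of_lt_of_le (by positivity) hN
  have hY : AEMeasurable Y P := (hid ⟨0, by exact_mod_cast hN₀⟩).aemeasurable_snd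
  have := Measure.isProbabilityMeasure_map hY
  rw [ExpShortfall.distFun_eq_cdf hY] at hσ hL hpos ⊢
  have hlaw : ∀ i, HasLaw (X i) (P.map Y) P := fun i => ⟨(hid i).aemeasurable_fst, (hid i).map_eq⟩
  have htail := ExpShortfall.measureReal_abs_truncatedEstimator_sub_ge_le hlaw hind hα₀ hα₁
    hβ₁ hβ hβ₂ hσ hL hpos hε₀ hε₁ hN
  refine ⟨htail, fun hε₂ => (measureReal_mono fun ω hω => ?_).trans htail⟩
  have hthreshold : ε * ExpShortfall.esStdDev α (cdf (P.map Y)) + 32 * L * ε ^ 2 ≤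
      2 * ε * ExpShortfall.esStdDev α (cdf (P.map Y)) := by
    linarith [mul_le_mul_of_nonneg_left hε₂ hε₀.le]
  exact hthreshold.trans hω
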